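/- Let $K$ be a field, let $n\ge 0$ be an integer, and let $\Sigma_n$ be the Hirzebruch surface over $K$, obtained from two copies $U_0\times\mathbb P^1$ and $U_1\times\mathbb P^1$, where $U_j=\{z_j\neq 0\}\subset\mathbb P^1$ and $[z_0:z_1]$ are homogeneous coordinates on $\mathbb P^1$, by the gluing map $$([z_0:z_1],[y_0:y_1])\longmapsto\Big([z_0:z_1],\Big[y_0:\frac{z_1^n}{z_0^n}\,y_1\Big]\Big)$$ over $U_0\cap U_1$. Let $F_0=\{z_0=0\}$ and $E_\infty=\{y_1=0\}$, regarded as prime divisors on $\Sigma_n$. Let $a,b$ be integers, for instance such that the divisor $aE_\infty+bF_0$ is very ample. Then, for $$H^0(\Sigma_n,\mathcal O_{\Sigma_n}(aE_\infty+bF_0))=\{f\in K(\Sigma_n)^\times\mid \operatorname{div}(f)+aE_\infty+bF_0\ge 0\}\cup\{0\},$$ one has $$H^0(\Sigma_n,\mathcal O_{\Sigma_n}(aE_\infty+bF_0))=\bigoplus_{\substack{(k,m)\in\mathbb Z^2\\ k\ge 0,\ 0\le m\le a,\ k+nm\le b}}K\,\Big(\frac{z_1}{z_0}\Big)^k\Big(\frac{y_0}{y_1}\Big)^m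 .$$ That is, these monomials are linearly independent over $K$, and their $K$-linear span inside the function field $K(\Sigma_n)$ is $H^0(\Sigma_n,\mathcal O_{\Sigma_n}(aE_\infty+bF_0))$. -/

import Mathlib

open CategoryTheory CategoryTheory.Limits AlgebraicGeometry

universe u

noncomputable section

namespace Hirzebruch

/-! ### Gluing affine varieties with a common function field -/

section Gluing

variable {K L : Type u} [Field K] [Field L] [Algebra K L] {J : Type} [PartialOrder J]

/-- A family of subrings `R i` of a field, indexed by a partial order, such that `R i` is a
localization of `R j` at one function for `i ≤ j`, and such that the intersection of the loci of
`i` and `j` inside that of `k` is the locus of some `l`. -/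
class IsGluingFamily (R : J → Subalgebra K L) : Prop where
  antitone : ∀ {i j : J}, i ≤ j → R j ≤ R i
  exists_away : ∀ {i j : J}, i ≤ j → ∃ g ∈ R j, g ≠ 0 ∧ g⁻¹ ∈ R i ∧
    R i ≤ R j ⊔ Algebra.adjoin K {g⁻¹}
  directed : ∀ {i j k : J}, i ≤ k → j ≤ k → ∃ l, l ≤ i ∧ l ≤ j ∧ R l ≤ R i ⊔ R j

lemma exists_pow_mul_mem {A : Subalgebra K L}
    {g b : L} (hg : g ∈ A) (hg0 : g ≠ 0) (hb : b ∈ A ⊔ Algebra.adjoin K {g⁻¹}) :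
    ∃ k : ℕ, g ^ k * b ∈ A := by
  rw [← Algebra.adjoin_eq A, ← Algebra.adjoin_union] at hb
  induction hb using Algebra.adjoin_induction with
  | mem z hz =>
    rcases hz with hz | hz
    · exact ⟨0, by simpa using hz⟩
    · rw [Set.mem_singleton_iff] at hz
      exact ⟨1, by simp [hz, hg0]⟩
  | algebraMap r => exact ⟨0, by simp⟩
  | add z w _ _ hz hw =>
    obtain ⟨k, hk⟩ := hz
    obtain ⟨l, hl⟩ := hw
    refine ⟨k + l, ?_⟩
    have := add_mem (mul_mem (pow_mem hg l) hk) (mul_mem (pow_mem hg k) hl)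
    convert this using 1
    ring
  | mul z w _ _ hz hw =>
    obtain ⟨k, hk⟩ := hz
    obtain ⟨l, hl⟩ := hw
    refine ⟨k + l, ?_⟩
    convert mul_mem hk hl using 1
    ring

lemma isLocalization_away_of_le {A B : Subalgebra K L} (hAB : A ≤ B) {g : L} (hg : g ∈ A) (hg0 : g ≠ 0) (hgB : g⁻¹ ∈ B)
    (hB : B ≤ A ⊔ Algebra.adjoin K {g⁻¹}) :
    @IsLocalization.Away _ _ (⟨g, hg⟩ : A) B _
      ((Subalgebra.inclusion hAB).toRingHom.toAlgebra) := by
  let _ := (Subalgebra.inclusion hAB).toRingHom.toAlgebra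
  have hval : ∀ z : A, ((algebraMap A B z : B) : L) = z := fun _ => rfl
  refine IsLocalization.Away.mk _ ?_ ?_ ?_
  · refine IsUnit.of_mul_eq_one ⟨g⁻¹, hgB⟩ (Subtype.ext ?_)
    simp [hval, hg0]
  · rintro ⟨b, hb⟩
    obtain ⟨k, hk⟩ := exists_pow_mul_mem hg hg0 (hB hb)
    refine ⟨k, ⟨_, hk⟩, Subtype.ext ?_⟩
    simp [hval, mul_comm]
  · intro a b hab
    refine ⟨0, ?_⟩
    have := congrArg (Subtype.val) hab
    simp only [hval] at this
    simpa using Subtype.ext this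


variable (R : J → Subalgebra K L) [IsGluingFamily R]

/-- The inclusion of the ring `R j` in the ring `R i`, for `i ≤ j`. -/
def restrict {i j : J} (h : i ≤ j) : R j →+* R i :=
  (Subalgebra.inclusion (IsGluingFamily.antitone h)).toRingHom

lemma restrict_injective {i j : J} (h : i ≤ j) : Function.Injective (restrict R h) :=
  Subalgebra.inclusion_injective _

lemma exists_isLocalization_away {i j : J} (h : i ≤ j) :
    ∃ g : R j, @IsLocalization.Away _ _ g (R i) _ (restrict R h).toAlgebra := by
  obtain ⟨g, hg, hg0, hgS, hS⟩ := IsGluingFamily.exists_away (R := R) h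
  exact ⟨⟨g, hg⟩, isLocalization_away_of_le (IsGluingFamily.antitone h) hg hg0 hgS hS⟩

lemma range_comap_restrict {i j : J} (h : i ≤ j) {g : L} (hg : g ∈ R j) (hg0 : g ≠ 0)
    (hgi : g⁻¹ ∈ R i) (hgs : R i ≤ R j ⊔ Algebra.adjoin K {g⁻¹}) :
    Set.range (PrimeSpectrum.comap (restrict R h)) =
      {p : PrimeSpectrum (R j) | (⟨g, hg⟩ : R j) ∉ p.asIdeal} :=
  @PrimeSpectrum.localization_away_comap_range _ _ (R i) _ (restrict R h).toAlgebra ⟨g, hg⟩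
    (isLocalization_away_of_le (IsGluingFamily.antitone h) hg hg0 hgi hgs)

/-- The gluing diagram: the spectra of the rings and the morphisms given by their inclusions. -/
def gluingDiagram : J ⥤ Scheme.{u} where
  obj i := Spec (CommRingCat.of (R i))
  map f := Spec.map (CommRingCat.ofHom (restrict R (leOfHom f)))
  map_id _ := Spec.map_id _
  map_comp _ _ := by
    rw [← Spec.map_comp]
    rfl

instance {i j : J} (f : i ⟶ j) : IsOpenImmersion ((gluingDiagram R).map f) := by
  obtain ⟨g, hg⟩ := exists_isLocalization_away R (leOfHom f)
  exact @IsOpenImmersion.of_isLocalization _ _ _ _ (restrict R (leOfHom f)).toAlgebra g hg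

lemma isOpenImmersion_restrict {i j : J} (h : i ≤ j) :
    IsOpenImmersion (Spec.map (CommRingCat.ofHom (restrict R h))) :=
  inferInstanceAs (IsOpenImmersion ((gluingDiagram R).map (homOfLE h)))

instance : (gluingDiagram R ⋙ Scheme.forget).IsLocallyDirected where
  cond {i j k} fi fj xi xj h := by
    obtain ⟨l, hli, hlj, hl⟩ := IsGluingFamily.directed (R := R) (leOfHom fi) (leOfHom fj)
    have hlk := hli.trans (leOfHom fi)
    obtain ⟨g, hg, hg0, hgi, hgs⟩ := IsGluingFamily.exists_away (R := R) (leOfHom fi)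
    obtain ⟨g', hg', hg0', hgi', hgs'⟩ := IsGluingFamily.exists_away (R := R) (leOfHom fj)
    have hB : R l ≤ R k ⊔ Algebra.adjoin K {(g * g')⁻¹} := by
      set B := R k ⊔ Algebra.adjoin K {(g * g')⁻¹}
      have hk : R k ≤ B := le_sup_left
      have h1 : (g * g')⁻¹ ∈ B :=
        (le_sup_right : Algebra.adjoin K _ ≤ B) (Algebra.subset_adjoin rfl)
      have h2 : g⁻¹ ∈ B := by
        have := mul_mem (hk hg') h1
        rwa [mul_inv, mul_left_comm, mul_inv_cancel₀ hg0', mul_one] at this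
      have h3 : g'⁻¹ ∈ B := by
        have := mul_mem (hk hg) h1
        rwa [mul_inv, ← mul_assoc, mul_inv_cancel₀ hg0, one_mul] at this
      refine hl.trans (sup_le (hgs.trans (sup_le hk ?_)) (hgs'.trans (sup_le hk ?_)))
      · simpa [Algebra.adjoin_le_iff] using h2
      · simpa [Algebra.adjoin_le_iff] using h3
    have hgg : (g * g')⁻¹ ∈ R l := by
      rw [mul_inv]
      exact mul_mem (IsGluingFamily.antitone hli hgi) (IsGluingFamily.antitone hlj hgi')
    have hli' := range_comap_restrict R (leOfHom fi) hg hg0 hgi hgs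
    have hlj' := range_comap_restrict R (leOfHom fj) hg' hg0' hgi' hgs'
    have hlk' := range_comap_restrict R hlk (mul_mem hg hg') (mul_ne_zero hg0 hg0') hgg hB
    have hp : (gluingDiagram R).map fi xi ∈ Set.range ((gluingDiagram R).map (homOfLE hlk)) := by
      refine hlk'.symm ▸ ?_
      intro hmem
      have hmul : (⟨g, hg⟩ * ⟨g', hg'⟩ : R k) ∈
        PrimeSpectrum.asIdeal (R := R k) ((gluingDiagram R).map fi xi) := hmem
      rcases ((PrimeSpectrum.isPrime (R := R k)
        ((gluingDiagram R).map fi xi)).mem_or_mem hmul) with hm | hm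
      · have h1 : (gluingDiagram R).map fi xi ∈ Set.range ((gluingDiagram R).map fi) := ⟨xi, rfl⟩
        exact (hli'.subset h1 : _ ∉ _) hm
      · have h' : (gluingDiagram R).map fi xi = (gluingDiagram R).map fj xj := h
        rw [h'] at hm
        have h1 : (gluingDiagram R).map fj xj ∈ Set.range ((gluingDiagram R).map fj) := ⟨xj, rfl⟩
        exact (hlj'.subset h1 : _ ∉ _) hm
    obtain ⟨z, hz⟩ := hp
    refine ⟨l, homOfLE hli, homOfLE hlj, z, ?_, ?_⟩
    · apply ((gluingDiagram R).map fi).isOpenEmbedding.injective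
      rw [← hz]
      change ((gluingDiagram R).map (homOfLE hli) ≫ (gluingDiagram R).map fi) z = _
      rw [← Functor.map_comp]
      rfl
    · apply ((gluingDiagram R).map fj).isOpenEmbedding.injective
      refine Eq.trans ?_ h
      change _ = (gluingDiagram R).map fi xi
      rw [← hz]
      change ((gluingDiagram R).map (homOfLE hlj) ≫ (gluingDiagram R).map fj) z = _
      rw [← Functor.map_comp]
      rfl

variable [Small.{u} J]

/-- The scheme obtained by gluing the spectra of the rings `R i`. -/
def gluedScheme : Scheme.{u} := colimit (gluingDiagram R)

/-- The inclusion of the open subscheme `Spec (R i)`. -/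
def gluedι (i : J) : Spec (CommRingCat.of (R i)) ⟶ gluedScheme R :=
  colimit.ι (gluingDiagram R) i

instance (i : J) : IsOpenImmersion (gluedι R i) :=
  inferInstanceAs (IsOpenImmersion (colimit.ι (gluingDiagram R) i))

lemma gluedι_comp {i j : J} (h : i ≤ j) :
    Spec.map (CommRingCat.ofHom (restrict R h)) ≫ gluedι R j = gluedι R i :=
  colimit.w (gluingDiagram R) (homOfLE h)

lemma exists_gluedι_eq (p : gluedScheme R) : ∃ (i : J) (q : _), gluedι R i q = p :=
  Scheme.IsLocallyDirected.ι_jointly_surjective (gluingDiagram R) p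

instance : IsReduced (gluedScheme R) := by
  have : ∀ i, IsReduced ((Scheme.IsLocallyDirected.openCover (gluingDiagram R)).X i) := fun i =>
    inferInstanceAs (IsReduced (Spec (CommRingCat.of (R i))))
  exact IsReduced.of_openCover _ (Scheme.IsLocallyDirected.openCover (gluingDiagram R))

instance [OrderBot J] : IrreducibleSpace (gluedScheme R) := by
  let η : gluedScheme R := gluedι R ⊥ (genericPoint (Spec (CommRingCat.of (R ⊥))))
  have h : closure {η} = Set.univ := by
    refine Set.eq_univ_of_forall fun p => ?_
    rw [← specializes_iff_mem_closure]
    obtain ⟨i, q, rfl⟩ := exists_gluedι_eq R p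
    have : η = gluedι R i (genericPoint (Spec (CommRingCat.of (R i)))) := by
      have := isOpenImmersion_restrict R (bot_le : (⊥ : J) ≤ i)
      rw [← genericPoint_eq_of_isOpenImmersion
        (Spec.map (CommRingCat.ofHom (restrict R (bot_le : (⊥ : J) ≤ i)))),
        ← Scheme.Hom.comp_apply, gluedι_comp]
    rw [this]
    exact (genericPoint_specializes q).map (gluedι R i).continuous
  have h' : IsIrreducible (closure {η}) := isIrreducible_singleton.closure
  rw [h] at h'
  exact (irreducibleSpace_def _).mpr h'

instance [OrderBot J] : IsIntegral (gluedScheme R) :=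
  isIntegral_of_irreducibleSpace_of_isReduced _

instance [∀ i, IsNoetherianRing (R i)] : IsLocallyNoetherian (gluedScheme R) := by
  have : ∀ i, IsAffine ((Scheme.IsLocallyDirected.openCover (gluingDiagram R)).X i) := fun i =>
    inferInstanceAs (IsAffine (Spec (CommRingCat.of (R i))))
  refine (isLocallyNoetherian_iff_of_affine_openCover
    (Scheme.IsLocallyDirected.openCover (gluingDiagram R))).mpr fun i => ?_
  have : IsNoetherianRing (R (show J from i)) := inferInstance
  exact isNoetherianRing_of_ringEquiv (R (show J from i))
    (Scheme.ΓSpecIso (CommRingCat.of (R (show J from i)))).symm.commRingCatIsoToRingEquiv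

instance (i : J) : Nonempty (gluedι R i).opensRange :=
  ⟨⟨gluedι R i (genericPoint (Spec (CommRingCat.of (R i)))), ⟨_, rfl⟩⟩⟩

/-- The ring `R i` of functions on the open subset `Spec (R i)`, as a subring of the function
field. -/
def toFunctionField [OrderBot J] (i : J) : R i →+* (gluedScheme R).functionField :=
  ((Scheme.ΓSpecIso (CommRingCat.of (R i))).inv ≫ (IsOpenImmersion.ΓIsoTop (gluedι R i)).hom ≫
    (gluedScheme R).germToFunctionField (gluedι R i).opensRange).hom

end Gluing

/-! ### Families of charts -/

section Charts

variable {K L : Type u} [Field K] [Field L] [Algebra K L] {ι : Type}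

/-- Nonempty sets of charts, ordered by reverse inclusion: they index the nonempty intersections
of charts. -/
abbrev Overlap (ι : Type) : Type := {S : Finset ι // S.Nonempty}ᵒᵈ

instance [Fintype ι] [Nonempty ι] : OrderBot (Overlap ι) where
  bot := OrderDual.toDual ⟨Finset.univ, Finset.univ_nonempty⟩
  bot_le _ := Finset.subset_univ _

instance [Finite ι] : Finite (Overlap ι) :=
  inferInstanceAs (Finite {S : Finset ι // S.Nonempty})

/-- The chart `c`, regarded as an intersection of charts. -/
def single (c : ι) : Overlap ι := OrderDual.toDual ⟨{c}, Finset.singleton_nonempty c⟩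

variable (K) in
/-- The coordinate ring of the intersection of the charts in `S`, if the coordinate ring of the
chart `c` is generated by `G c`: it is generated by the coordinate rings of these charts. -/
def overlapRing (G : ι → Set L) (S : Overlap ι) : Subalgebra K L :=
  Algebra.adjoin K (⋃ c ∈ (OrderDual.ofDual S).1, G c)

lemma adjoin_le_overlapRing (G : ι → Set L) {S : Overlap ι} {c : ι}
    (hc : c ∈ (OrderDual.ofDual S).1) : Algebra.adjoin K (G c) ≤ overlapRing K G S :=
  Algebra.adjoin_mono (Set.subset_biUnion_of_mem (u := G) hc)

lemma overlapRing_le (G : ι → Set L) {S : Overlap ι} {B : Subalgebra K L}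
    (h : ∀ c ∈ (OrderDual.ofDual S).1, Algebra.adjoin K (G c) ≤ B) :
    overlapRing K G S ≤ B := by
  simp only [overlapRing, Algebra.adjoin_le_iff, Set.iUnion_subset_iff] at h ⊢
  exact h

lemma overlapRing_antitone (G : ι → Set L) {S T : Overlap ι} (h : S ≤ T) :
    overlapRing K G T ≤ overlapRing K G S :=
  overlapRing_le G fun _ hc => adjoin_le_overlapRing G (h hc)

/-- If the intersection of any two charts is a principal open subset of either of them, then the
overlaps of the charts form a gluing family. -/
lemma isGluingFamily_overlapRing (G : ι → Set L)
    (hG : ∀ c d, ∃ g ∈ Algebra.adjoin K (G c), g ≠ 0 ∧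
      g⁻¹ ∈ Algebra.adjoin K (G c) ⊔ Algebra.adjoin K (G d) ∧
      Algebra.adjoin K (G d) ≤ Algebra.adjoin K (G c) ⊔ Algebra.adjoin K {g⁻¹}) :
    IsGluingFamily (overlapRing K G) where
  antitone := overlapRing_antitone G
  directed {S T U} _ _ := by
    classical
    refine ⟨OrderDual.toDual ⟨(OrderDual.ofDual S).1 ∪ (OrderDual.ofDual T).1,
      (OrderDual.ofDual S).2.mono Finset.subset_union_left⟩, Finset.subset_union_left,
      Finset.subset_union_right, overlapRing_le G fun c hc => ?_⟩
    rcases Finset.mem_union.mp hc with hc | hc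
    · exact (adjoin_le_overlapRing G hc).trans le_sup_left
    · exact (adjoin_le_overlapRing G hc).trans le_sup_right
  exists_away {S T} hST := by
    classical
    obtain ⟨c, hc⟩ := (OrderDual.ofDual T).2
    have hcT := adjoin_le_overlapRing (K := K) G hc
    choose g hg hg0 hgi hgs using hG c
    refine ⟨∏ d ∈ (OrderDual.ofDual S).1, g d, prod_mem fun d _ => hcT (hg d),
      Finset.prod_ne_zero_iff.mpr fun d _ => hg0 d, ?_, ?_⟩
    · rw [← Finset.prod_inv_distrib]
      exact prod_mem fun d hd =>
        (sup_le (adjoin_le_overlapRing G (hST hc)) (adjoin_le_overlapRing G hd)) (hgi d)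
    · refine overlapRing_le G fun d hd => (hgs d).trans (sup_le (hcT.trans le_sup_left) ?_)
      rw [Algebra.adjoin_le_iff, Set.singleton_subset_iff]
      set B := overlapRing K G T ⊔ Algebra.adjoin K {(∏ d ∈ (OrderDual.ofDual S).1, g d)⁻¹}
      have h1 : (∏ d ∈ (OrderDual.ofDual S).1, g d)⁻¹ ∈ B :=
        (le_sup_right : Algebra.adjoin K _ ≤ B) (Algebra.subset_adjoin rfl)
      have h2 : ∏ e ∈ (OrderDual.ofDual S).1.erase d, g e ∈ B :=
        prod_mem fun e _ => (le_sup_left : _ ≤ B) (hcT (hg e))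
      have h3 : ∏ e ∈ (OrderDual.ofDual S).1.erase d, g e ≠ 0 :=
        Finset.prod_ne_zero_iff.mpr fun d _ => hg0 d
      have := mul_mem h2 h1
      rwa [← Finset.mul_prod_erase _ _ hd, mul_inv, mul_left_comm, mul_inv_cancel₀ h3,
        mul_one] at this

lemma isNoetherianRing_overlapRing (G : ι → Set L) (hG : ∀ c, (G c).Finite) (S : Overlap ι) :
    IsNoetherianRing (overlapRing K G S) := by
  have h : (⋃ c ∈ (OrderDual.ofDual S).1, G c).Finite :=
    (OrderDual.ofDual S).1.finite_toSet.biUnion fun c _ => hG c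
  have : Algebra.FiniteType K (overlapRing K G S) :=
    (Subalgebra.fg_iff_finiteType _).mp (Subalgebra.fg_def.mpr ⟨_, h, rfl⟩)
  exact Algebra.FiniteType.isNoetherianRing K _

end Charts

/-! ### The coordinate rings of the four standard affine charts -/

/-- The field `K(x, y)` of rational functions in two variables. -/
abbrev RatFun (K : Type u) [Field K] : Type u := FractionRing (MvPolynomial (Fin 2) K)

variable (K : Type u) [Field K] (n : ℕ)

/-- The variable `x = z₁ / z₀`, the affine coordinate on the base of the chart `z₀ ≠ 0`. -/
def x : RatFun K := algebraMap (MvPolynomial (Fin 2) K) (RatFun K) (MvPolynomial.X 0)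

/-- The variable `y = y₀ / y₁`, where `[y₀ : y₁]` is the fibre coordinate over `z₀ ≠ 0`. -/
def y : RatFun K := algebraMap (MvPolynomial (Fin 2) K) (RatFun K) (MvPolynomial.X 1)

/-- The affine coordinate on `U_i = {z_i ≠ 0} ⊆ ℙ¹`: it is `z₁ / z₀` on `U_0`
and `z₀ / z₁` on `U_1`. -/
def baseCoord (i : Fin 2) : RatFun K := ![x K, (x K)⁻¹] i

/-- The ratio of the two homogeneous coordinates of the fibre over `U_i`: it is `y₀ / y₁` over
`U_0`, and `w₀ / w₁ = y₀ / ((z₁ / z₀) ^ n * y₁)` over `U_1`, according to the gluing map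
`([z₀ : z₁], [y₀ : y₁]) ↦ ([z₀ : z₁], [y₀ : (z₁ / z₀) ^ n * y₁])`. -/
def fibreRatio (i : Fin 2) : RatFun K := ![y K, y K / x K ^ n] i

/-- The affine coordinate of the fibre in the chart `(i, j)`, that is on `{y_j ≠ 0}` over `U_0`
(for `i = 0`) or on `{w_j ≠ 0}` over `U_1` (for `i = 1`). -/
def fibreCoord (i j : Fin 2) : RatFun K := ![(fibreRatio K n i)⁻¹, fibreRatio K n i] j

/-- The two affine coordinates of the chart `c`. -/
def chartCoords (c : Fin 2 × Fin 2) : Set (RatFun K) :=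
  {baseCoord K c.1, fibreCoord K n c.1 c.2}

/-- The coordinate ring of the chart `(i, j)`: polynomials in the base coordinate on `U_i` and
the fibre coordinate on `{y_j ≠ 0}` (resp. `{w_j ≠ 0}`). -/
def chartRing (c : Fin 2 × Fin 2) : Subalgebra K (RatFun K) :=
  Algebra.adjoin K (chartCoords K n c)

lemma x_ne_zero : x K ≠ 0 := by
  simp [x]

lemma y_ne_zero : y K ≠ 0 := by
  simp [y]

/-- The function on the chart `c` whose non-vanishing cuts out the overlap with the chart `d`. -/
def transitionFun (c d : Fin 2 × Fin 2) : RatFun K :=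
  (if c.1 = d.1 then 1 else baseCoord K c.1) * (if c.2 = d.2 then 1 else fibreCoord K n c.1 c.2)

lemma transitionFun_ne_zero (c d : Fin 2 × Fin 2) : transitionFun K n c d ≠ 0 := by
  have hx := x_ne_zero K
  have hy := y_ne_zero K
  obtain ⟨i, j⟩ := c
  fin_cases i <;> fin_cases j <;>
    simp only [transitionFun, baseCoord, fibreCoord, fibreRatio] <;> split_ifs <;> simp [hx, hy]

lemma baseCoord_mem (c : Fin 2 × Fin 2) : baseCoord K c.1 ∈ chartRing K n c :=
  Algebra.subset_adjoin (by simp [chartCoords])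

lemma fibreCoord_mem (c : Fin 2 × Fin 2) : fibreCoord K n c.1 c.2 ∈ chartRing K n c :=
  Algebra.subset_adjoin (by simp [chartCoords])

lemma transitionFun_mem (c d : Fin 2 × Fin 2) : transitionFun K n c d ∈ chartRing K n c := by
  unfold transitionFun
  refine mul_mem ?_ ?_ <;> split_ifs
  exacts [one_mem _, baseCoord_mem K n c, one_mem _, fibreCoord_mem K n c]

lemma coords_mem_of_inv_mem {c d : Fin 2 × Fin 2} {B : Subalgebra K (RatFun K)}
    (hu : baseCoord K c.1 ∈ B) (hv : fibreCoord K n c.1 c.2 ∈ B)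
    (hu' : c.1 ≠ d.1 → (baseCoord K c.1)⁻¹ ∈ B)
    (hv' : c.2 ≠ d.2 → (fibreCoord K n c.1 c.2)⁻¹ ∈ B) :
    baseCoord K d.1 ∈ B ∧ fibreCoord K n d.1 d.2 ∈ B := by
  have hx := x_ne_zero K
  have hy := y_ne_zero K
  obtain ⟨i, j⟩ := c
  obtain ⟨i', j'⟩ := d
  have key : ∀ r s t : RatFun K, s ∈ B → t ∈ B → r = s * t ^ n → r ∈ B :=
    fun r s t hs ht hr => hr ▸ mul_mem hs (pow_mem ht n)
  fin_cases i <;> fin_cases j <;> fin_cases i' <;> fin_cases j' <;>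
    simp [baseCoord, fibreCoord, fibreRatio] at hu hv hu' hv' ⊢ <;>
    first
      | exact ⟨hu, hv⟩
      | exact ⟨hu, hv'⟩
      | (refine ⟨hu', key _ _ _ hv hu ?_⟩; simp only [inv_pow]; field_simp; done)
      | (refine ⟨hu', key _ _ _ hv' hu ?_⟩; simp only [inv_pow]; field_simp; done)
      | (refine ⟨hu', key _ _ _ hv hu' ?_⟩; simp only [inv_pow]; field_simp; done)
      | (refine ⟨hu', key _ _ _ hv' hu' ?_⟩; simp only [inv_pow]; field_simp; done)
      | (refine ⟨hu', key _ _ _ hv hu ?_⟩; field_simp; done)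
      | (refine ⟨hu', key _ _ _ hv' hu ?_⟩; field_simp; done)
      | (refine ⟨hu', key _ _ _ hv hu' ?_⟩; field_simp; done)
      | (refine ⟨hu', key _ _ _ hv' hu' ?_⟩; field_simp; done)

lemma inv_transitionFun_mem (c d : Fin 2 × Fin 2) :
    (transitionFun K n c d)⁻¹ ∈ chartRing K n c ⊔ chartRing K n d := by
  have hx := x_ne_zero K
  have hy := y_ne_zero K
  set B := chartRing K n c ⊔ chartRing K n d with hB
  have h1 : chartRing K n c ≤ B := le_sup_left
  have h2 : chartRing K n d ≤ B := le_sup_right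
  have hu := h1 (baseCoord_mem K n c)
  have hv := h1 (fibreCoord_mem K n c)
  have hu' := h2 (baseCoord_mem K n d)
  have hv' := h2 (fibreCoord_mem K n d)
  clear_value B
  clear hB h1 h2
  have key : ∀ r s t : RatFun K, s ∈ B → t ∈ B → r = s * t ^ n → r ∈ B :=
    fun r s t hs ht hr => hr ▸ mul_mem hs (pow_mem ht n)
  unfold transitionFun
  rw [mul_inv]
  obtain ⟨i, j⟩ := c
  obtain ⟨i', j'⟩ := d
  refine mul_mem ?_ ?_ <;> split_ifs with h
  · simp
  · fin_cases i <;> fin_cases i' <;> simp [baseCoord] at h hu hu' ⊢ <;> assumption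
  · simp
  · fin_cases i <;> fin_cases j <;> fin_cases i' <;> fin_cases j' <;>
    simp [baseCoord, fibreCoord, fibreRatio] at h hu hu' hv hv' ⊢ <;>
    first
      | exact hv'
      | (refine key _ _ _ hv' hu ?_; simp only [inv_pow]; field_simp; done)
      | (refine key _ _ _ hv' hu' ?_; simp only [inv_pow]; field_simp; done)
      | (refine key _ _ _ hv' hu ?_; field_simp; done)
      | (refine key _ _ _ hv' hu' ?_; field_simp; done)

lemma chartRing_le_sup_adjoin (c d : Fin 2 × Fin 2) :
    chartRing K n d ≤ chartRing K n c ⊔ Algebra.adjoin K {(transitionFun K n c d)⁻¹} := by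
  set B := chartRing K n c ⊔ Algebra.adjoin K {(transitionFun K n c d)⁻¹} with hB
  have h1 : chartRing K n c ≤ B := le_sup_left
  have hg : (transitionFun K n c d)⁻¹ ∈ B :=
    (le_sup_right : Algebra.adjoin K _ ≤ B) (Algebra.subset_adjoin rfl)
  have hg0 := transitionFun_ne_zero K n c d
  have hu := h1 (baseCoord_mem K n c)
  have hv := h1 (fibreCoord_mem K n c)
  have := coords_mem_of_inv_mem K n (c := c) (d := d) (B := B) hu hv ?_ ?_
  · rw [chartRing, Algebra.adjoin_le_iff]
    rintro _ (rfl | rfl)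
    exacts [this.1, this.2]
  · intro h
    by_cases h' : c.2 = d.2
    · simpa [transitionFun, h, h'] using hg
    · simp only [transitionFun, h, h', if_false] at hg hg0
      have := mul_mem hv hg
      rwa [mul_inv, mul_left_comm, mul_inv_cancel₀ (right_ne_zero_of_mul hg0), mul_one] at this
  · intro h'
    by_cases h : c.1 = d.1
    · simpa [transitionFun, h, h'] using hg
    · simp only [transitionFun, h, h', if_false] at hg hg0
      have := mul_mem hu hg
      rwa [mul_inv, ← mul_assoc, mul_inv_cancel₀ (left_ne_zero_of_mul hg0), one_mul] at this

/-- The coordinate ring of the intersection of the charts in `S`. -/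
abbrev chartsRing : Overlap (Fin 2 × Fin 2) → Subalgebra K (RatFun K) :=
  overlapRing K (chartCoords K n)

instance : IsGluingFamily (chartsRing K n) :=
  isGluingFamily_overlapRing _ fun c d => ⟨transitionFun K n c d, transitionFun_mem K n c d,
    transitionFun_ne_zero K n c d, inv_transitionFun_mem K n c d, chartRing_le_sup_adjoin K n c d⟩

instance (S : Overlap (Fin 2 × Fin 2)) : IsNoetherianRing (chartsRing K n S) :=
  isNoetherianRing_overlapRing _ (fun c => by simp [chartCoords]) S

lemma chartRing_le_chartsRing (c : Fin 2 × Fin 2) :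
    chartRing K n c ≤ chartsRing K n (single c) :=
  adjoin_le_overlapRing _ (Finset.mem_singleton_self c)

/-! ### The surface and its rational functions -/

/-- The Hirzebruch surface `Σ_n` over `K`: the four affine planes
`{z_0 ≠ 0, y_j ≠ 0}`, `{z_1 ≠ 0, w_j ≠ 0}` (`j = 0, 1`) glued along their overlaps. -/
abbrev surface : Scheme.{u} := gluedScheme (chartsRing K n)

/-- The inclusion of the chart `c` in the Hirzebruch surface. -/
abbrev chart (c : Fin 2 × Fin 2) :
    Spec (CommRingCat.of (chartsRing K n (single c))) ⟶ surface K n :=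
  gluedι (chartsRing K n) (single c)

/-- Regular functions on the chart `{z₀ ≠ 0, y₁ ≠ 0}` as rational functions on `Σ_n`. -/
abbrev ofChart : chartsRing K n (single (0, 1)) →+* (surface K n).functionField :=
  toFunctionField (chartsRing K n) (single (0, 1))

/-- The function field of `Σ_n` as an extension of `K`, the scalars being the constant
functions. -/
instance : Algebra K (surface K n).functionField :=
  ((ofChart K n).comp (algebraMap K (chartsRing K n (single (0, 1))))).toAlgebra

/-- The rational function `z₁ / z₀` on `Σ_n`. -/
def zRatio : (surface K n).functionField :=
  ofChart K n ⟨baseCoord K 0, chartRing_le_chartsRing K n (0, 1) (baseCoord_mem K n (0, 1))⟩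

/-- The rational function `y₀ / y₁` on `Σ_n`. -/
def yRatio : (surface K n).functionField :=
  ofChart K n ⟨fibreCoord K n 0 1, chartRing_le_chartsRing K n (0, 1) (fibreCoord_mem K n (0, 1))⟩

/-! ### Divisors and global sections -/

/-- The curve `E_∞ = {y₁ = 0}`: the points outside the charts `{z₀ ≠ 0, y₁ ≠ 0}` and
`{z₁ ≠ 0, w₁ ≠ 0}`. -/
def EInfty : Set (surface K n) := {p | ∀ i : Fin 2, p ∉ Set.range (chart K n (i, 1))}

/-- The fibre `F_0 = {z₀ = 0}`: the points outside the two charts over `U_0 = {z₀ ≠ 0}`. -/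
def FZero : Set (surface K n) := {p | ∀ j : Fin 2, p ∉ Set.range (chart K n (0, j))}

/-- The cycle `1 · Z` of an irreducible closed subset `Z` of a scheme: the coefficient is `1` at
the generic point of `Z` and `0` elsewhere. -/
def primeCycle {X : Scheme.{u}} (Z : Set X) : AlgebraicCycle X ℤ where
  toFun := Set.indicator {p | IsGenericPoint p Z} 1
  supportWithinDomain' := Set.subset_univ _
  supportLocallyFiniteWithinDomain' _ _ :=
    ⟨Set.univ, Filter.univ_mem, by
      refine Set.Finite.subset (s := {p | IsGenericPoint p Z}) ?_
        (Set.inter_subset_right.trans Set.support_indicator_subset)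
      exact Set.Subsingleton.finite fun p hp q hq => hp.eq hq⟩

/-- The divisor `a E_∞ + b F_0` on `Σ_n`. -/
def divisor (a b : ℤ) : AlgebraicCycle (surface K n) ℤ :=
  a • primeCycle (EInfty K n) + b • primeCycle (FZero K n)

/-- `H⁰(X, 𝒪_X(D)) = {f ∈ K(X) | div f + D ≥ 0} ∪ {0}` for a Weil divisor `D`: the order of `f`
along each prime divisor, that is at each point of codimension one, is at least minus the
coefficient of `D`. -/
def globalSections {X : Scheme.{u}} [IsIntegral X] [IsLocallyNoetherian X]
    (D : AlgebraicCycle X ℤ) : Set X.functionField :=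
  {f | f = 0 ∨ ∀ p : X, Order.coheight p = 1 → 0 ≤ Scheme.ord f p + D p}

/-- The pairs `(k, m)` of integers with `k ≥ 0`, `0 ≤ m ≤ a` and `k + n m ≤ b`. -/
def exponents (a b : ℤ) : Set (ℤ × ℤ) :=
  {p | 0 ≤ p.1 ∧ 0 ≤ p.2 ∧ p.2 ≤ a ∧ p.1 + n * p.2 ≤ b}

/-- The rational function `(z₁ / z₀) ^ k * (y₀ / y₁) ^ m` for `p = (k, m)`. -/
def monomial (p : ℤ × ℤ) : (surface K n).functionField :=
  zRatio K n ^ p.1 * yRatio K n ^ p.2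

end Hirzebruch

end

/-!
The four charts of `Σ_n` are affine planes: the coordinate ring of each is a polynomial ring in two
Laurent monomials in `x = z₁ / z₀` and `y = y₀ / y₁` (`chartEquiv`), and hence a factorial ring
which is spanned over `K` by the Laurent monomials with exponents in a cone
(`mem_chartsRing_single_iff`). The curves `E_∞` and `F_0` are cut out on each chart by a coordinate
or by `1` (`primeCycle_EInfty`, `primeCycle_FZero`). So the condition `div f + a E_∞ + b F_0 ≥ 0`
says on a chart that the product of `f` and a certain Laurent monomial has nonnegative order along
all prime divisors meeting the chart. Since the coordinate ring is factorial, this means that the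
product is a regular function on the chart (`mem_range_toRational`).

Hence the sections over a chart are the combinations of the Laurent monomials with exponents in a
translate of a cone (`chartCone`). As the Laurent monomials are linearly independent
(`linearIndependent_laurent`), the global sections are the combinations of those with exponents in
the intersection of the four translated cones, which is `exponents n a b`.

The orders of vanishing are computed in the local rings of the glued scheme, which are localizations
of the coordinate rings of the charts (`isLocalization_stalk`); rational functions on the
surface are compared with elements of `K(x, y)` by `ratHom`.
-/

noncomputable section

namespace Hirzebruch

/-! ### Orders of vanishing on affine charts of an integral scheme -/

section AffineChart

variable {X : Scheme.{u}} {R : CommRingCat.{u}} (f : Spec R ⟶ X) [IsOpenImmersion f]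

/-- The functions on `Spec R`, as sections of `X` over the image of an open immersion. -/
def sectionsIso : R ≅ Γ(X, f.opensRange) :=
  (Scheme.ΓSpecIso R).symm ≪≫ IsOpenImmersion.ΓIsoTop f

lemma mem_opensRange (q : Spec R) : f q ∈ f.opensRange := ⟨q, rfl⟩

/-- The germ of a function on an affine chart `f : Spec R ⟶ X` at the point `f q`. -/
def toStalk (q : Spec R) : R →+* X.presheaf.stalk (f q) :=
  ((sectionsIso f).hom ≫ X.presheaf.germ f.opensRange (f q) (mem_opensRange f q)).hom

/-- The isomorphism of stalks induced by the open immersion `f` identifies `toStalk f q` with the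
canonical map from `R` to the stalk of `Spec R` at `q`. -/
lemma stalkMap_toStalk (q : Spec R) (r : R) :
    f.stalkMap q (toStalk f q r) = StructureSheaf.toStalk R q r := by
  have h1 : (sectionsIso f).hom ≫ X.presheaf.germ f.opensRange (f q) (mem_opensRange f q) ≫
      f.stalkMap q = (Scheme.ΓSpecIso R).inv ≫ (Spec R).presheaf.germ ⊤ q trivial := by
    simp only [sectionsIso, IsOpenImmersion.ΓIsoTop, Iso.trans_hom, Iso.symm_hom, Category.assoc,
      Functor.mapIso_hom, Iso.op_hom, eqToIso.hom]
    rw [X.presheaf.germ_res_assoc, Scheme.Hom.germ_stalkMap, Scheme.Hom.appIso_inv_app_assoc]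
    exact congr(_ ≫ $((Spec R).presheaf.germ_res _ _ _))
  have h2 : (Scheme.ΓSpecIso R).inv ≫ (Spec R).presheaf.germ ⊤ q trivial =
      StructureSheaf.toStalk R q :=
    StructureSheaf.algebraMap_germ ⊤ q trivial
  exact congr($(h1.trans h2) r)

lemma isLocalization_stalk (q : Spec R) :
    @IsLocalization.AtPrime R _ (X.presheaf.stalk (f q)) _ (toStalk f q).toAlgebra
      q.asIdeal (PrimeSpectrum.isPrime q) := by
  let _ := (toStalk f q).toAlgebra
  have := PrimeSpectrum.isPrime q
  let _ : Algebra R ((Spec R).presheaf.stalk q) := StructureSheaf.stalkAlgebra R q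
  have : IsLocalization.AtPrime ((Spec R).presheaf.stalk q) q.asIdeal :=
    StructureSheaf.IsLocalization.to_stalk R q
  let e : X.presheaf.stalk (f q) ≃ₐ[R] (Spec R).presheaf.stalk q :=
    { (asIso (f.stalkMap q)).commRingCatIsoToRingEquiv with
      commutes' := stalkMap_toStalk f q }
  exact IsLocalization.isLocalization_of_algEquiv _ e.symm

lemma isUnit_toStalk_iff (q : Spec R) (r : R) : IsUnit (toStalk f q r) ↔ r ∉ q.asIdeal := by
  let _ := (toStalk f q).toAlgebra
  have := PrimeSpectrum.isPrime q
  have := isLocalization_stalk f q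
  exact IsLocalization.AtPrime.isUnit_to_map_iff (X.presheaf.stalk (f q)) q.asIdeal r

lemma maximalIdeal_stalk_eq_span {q : Spec R} {r : R} (hq : q.asIdeal = Ideal.span {r}) :
    IsLocalRing.maximalIdeal (X.presheaf.stalk (f q)) = Ideal.span {toStalk f q r} := by
  let _ := (toStalk f q).toAlgebra
  have := PrimeSpectrum.isPrime q
  have := isLocalization_stalk f q
  rw [← IsLocalization.AtPrime.map_eq_maximalIdeal q.asIdeal, hq, Ideal.map_span,
    Set.image_singleton]
  rfl

lemma coheight_eq_height (q : Spec R) :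
    (Order.coheight (f q) : ℕ∞) = q.asIdeal.height := by
  rw [idealHeight_eq_coheight]
  exact coheight_eq_of_isOpenImmersion f

variable [IsIntegral X] [Nonempty f.opensRange]

/-- The functions on an affine chart `f : Spec R ⟶ X`, as rational functions on `X`. -/
def toRational : R →+* X.functionField :=
  ((sectionsIso f).hom ≫ X.germToFunctionField f.opensRange).hom

lemma algebraMap_toStalk (q : Spec R) (r : R) :
    algebraMap (X.presheaf.stalk (f q)) X.functionField (toStalk f q r) = toRational f r :=
  Scheme.algebraMap_germ_eq_germToFunctionField X (mem_opensRange f q) _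

lemma toRational_injective : Function.Injective (toRational f) :=
  (X.germToFunctionField_injective f.opensRange).comp
    (sectionsIso f).commRingCatIsoToRingEquiv.injective

lemma toStalk_ne_zero (q : Spec R) {r : R} (hr : r ≠ 0) : toStalk f q r ≠ 0 := by
  intro h
  refine hr (toRational_injective f ?_)
  rw [← algebraMap_toStalk f q, h, map_zero, map_zero]

lemma exists_eq_toRational_div (g : X.functionField) :
    ∃ a b : R, b ≠ 0 ∧ g = toRational f a / toRational f b := by
  have := functionField_isFractionRing_of_isAffineOpen X f.opensRange (isAffineOpen_opensRange f)
  obtain ⟨a, b, hb, rfl⟩ := IsFractionRing.div_surjective (A := Γ(X, f.opensRange)) g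
  let e := (sectionsIso f).commRingCatIsoToRingEquiv
  have he : ∀ s, toRational f (e.symm s) = algebraMap _ X.functionField s := fun s =>
    congrArg (X.germToFunctionField f.opensRange) (e.apply_symm_apply s)
  refine ⟨e.symm a, e.symm b, ?_, ?_⟩
  · simpa using nonZeroDivisors.ne_zero hb
  · rw [he, he]

variable [IsLocallyNoetherian X]

/-- For a nonzero germ `s`, the integer `Scheme.ord s z` is the length of the local ring modulo
`s`. -/
lemma ord_algebraMap_eq {z : X} (hz : Order.coheight z = 1) {s : X.presheaf.stalk z}
    (hs : s ≠ 0) :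
    ((Scheme.ord (algebraMap _ X.functionField s) z).toNat : ℕ∞) = Ring.ord _ s ∧
      0 ≤ Scheme.ord (algebraMap _ X.functionField s) z := by
  have : Ring.KrullDimLE 1 (X.presheaf.stalk z) := krullDimLE_of_coheight_le hz.le
  have hs' : s ∈ nonZeroDivisors (X.presheaf.stalk z) := mem_nonZeroDivisors_of_ne_zero hs
  obtain ⟨m, hm⟩ := ENat.ne_top_iff_exists.mp (Ring.ord_ne_top hs')
  have : Scheme.ord (algebraMap _ X.functionField s) z = m := by
    rw [Scheme.ord_eq_iff hz (by simpa using hs)]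
    exact (Ring.ordFrac_eq_ord _ hs).trans (Ring.ordMonoidWithZeroHom_eq_coe _ hs' hm.symm)
  rw [this, ← hm]
  simp

lemma ord_toRational_nonneg (q : Spec R) {r : R} (hr : r ≠ 0) :
    0 ≤ Scheme.ord (toRational f r) (f q) := by
  by_cases hz : Order.coheight (f q) = 1
  · rw [← algebraMap_toStalk f q]
    exact (ord_algebraMap_eq hz (toStalk_ne_zero f q hr)).2
  · rw [Scheme.ord_eq_zero_of_coheight_neq_one hz]

lemma ord_toRational_eq_zero {q : Spec R} {r : R} (hr : r ∉ q.asIdeal) :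
    Scheme.ord (toRational f r) (f q) = 0 := by
  by_cases hz : Order.coheight (f q) = 1
  · have hr0 : r ≠ 0 := fun h => hr (h ▸ zero_mem _)
    obtain ⟨h, h0⟩ := ord_algebraMap_eq hz (toStalk_ne_zero f q hr0)
    rw [Ring.ord_of_isUnit ((isUnit_toStalk_iff f q r).mpr hr), algebraMap_toStalk,
      Nat.cast_eq_zero] at h
    rw [algebraMap_toStalk] at h0
    omega
  · rw [Scheme.ord_eq_zero_of_coheight_neq_one hz]

lemma ord_toRational_pos {q : Spec R} (hq : Order.coheight (f q) = 1) {r : R} (hr : r ≠ 0)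
    (hrq : r ∈ q.asIdeal) : 0 < Scheme.ord (toRational f r) (f q) := by
  obtain ⟨h, h0⟩ := ord_algebraMap_eq hq (toStalk_ne_zero f q hr)
  rw [algebraMap_toStalk] at h h0
  refine lt_of_le_of_ne h0 fun h1 => ?_
  rw [← h1, Int.toNat_zero, Nat.cast_zero, eq_comm, Ring.ord, Module.length_eq_zero_iff,
    Submodule.Quotient.subsingleton_iff, Ideal.span_singleton_eq_top, isUnit_toStalk_iff] at h
  exact h hrq

lemma ord_toRational_eq_one {q : Spec R} (hq : Order.coheight (f q) = 1) {r : R} (hr : r ≠ 0)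
    (hrq : q.asIdeal = Ideal.span {r}) : Scheme.ord (toRational f r) (f q) = 1 := by
  obtain ⟨h, h0⟩ := ord_algebraMap_eq hq (toStalk_ne_zero f q hr)
  rw [algebraMap_toStalk] at h h0
  have : Ring.ord _ (toStalk f q r) = 1 := by
    rw [Ring.ord, Module.length_eq_one_iff, ← maximalIdeal_stalk_eq_span f hrq,
      isSimpleModule_iff_isCoatom, ← Ideal.isMaximal_def]
    infer_instance
  rw [this] at h
  have := Nat.cast_injective (h.trans Nat.cast_one.symm)
  omega

/-- A rational function without poles along the prime divisors meeting an affine chart whose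
coordinate ring is factorial is regular on the chart: a prime factor `π` of the denominator of a
reduced fraction would define a prime divisor along which the function has negative order. -/
lemma mem_range_toRational [IsDomain R] [IsNoetherianRing R] [UniqueFactorizationMonoid R]
    {g : X.functionField} (hg : g ≠ 0)
    (h : ∀ q : Spec R, Order.coheight (f q) = 1 → 0 ≤ Scheme.ord g (f q)) :
    ∃ r, toRational f r = g := by
  obtain ⟨a₀, b₀, hb₀, rfl⟩ := exists_eq_toRational_div f g
  obtain ⟨b, a, c, hab, rfl, rfl⟩ := UniqueFactorizationMonoid.exists_reduced_factors b₀ hb₀ a₀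
  have hc := left_ne_zero_of_mul hb₀
  have hb := right_ne_zero_of_mul hb₀
  have inj : ∀ {r : R}, r ≠ 0 → toRational f r ≠ 0 := fun hr =>
    (map_ne_zero_iff _ (toRational_injective f)).mpr hr
  rw [map_mul, map_mul, mul_div_mul_left _ _ (inj hc)] at hg h ⊢
  have ha : a ≠ 0 := by
    rintro rfl
    simp at hg
  by_cases hu : IsUnit b
  · obtain ⟨b', hb'⟩ := hu.exists_right_inv
    refine ⟨a * b', ?_⟩
    rw [eq_div_iff (inj hb), ← map_mul, mul_assoc, mul_comm b', hb', mul_one]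
  · exfalso
    obtain ⟨π, hπ, hπb⟩ := WfDvdMonoid.exists_irreducible_factor hu hb
    have hπ := hπ.prime
    have hprime : (Ideal.span {π}).IsPrime := (Ideal.span_singleton_prime hπ.ne_zero).mpr hπ
    let q : Spec R := (⟨Ideal.span {π}, hprime⟩ : PrimeSpectrum R)
    have hq : Order.coheight (f q) = 1 := by
      rw [coheight_eq_height]
      exact Ideal.height_span_singleton_eq_one_of_mem_nonZeroDivisors
        (mem_nonZeroDivisors_of_ne_zero hπ.ne_zero) hπ.not_isUnit
    have haq : a ∉ q.asIdeal := fun h =>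
      hπ.not_isUnit (hab hπb (Ideal.mem_span_singleton.mp h))
    have hbq : b ∈ q.asIdeal := Ideal.mem_span_singleton.mpr hπb
    have h1 := h q hq
    have h2 := ord_toRational_pos f hq hb hbq
    have h3 := Scheme.ord_mul (x := f q) hg (inj hb)
    rw [div_mul_cancel₀ _ (inj hb), ord_toRational_eq_zero f haq] at h3
    omega

end AffineChart

section Order

variable {X : Scheme.{u}} [IsIntegral X] [IsLocallyNoetherian X]

lemma ord_zpow (p : X) {f : X.functionField} (hf : f ≠ 0) (k : ℤ) :
    Scheme.ord (f ^ k) p = k * Scheme.ord f p := by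
  by_cases hp : Order.coheight p = 1
  · rw [Scheme.ord_eq_iff hp (zpow_ne_zero k hf), map_zpow₀,
      (Scheme.ord_eq_iff hp hf).mp rfl, ← smul_eq_mul, ofAdd_zsmul]
    rfl
  · simp [Scheme.ord_eq_zero_of_coheight_neq_one hp]

end Order

/-! ### Rational functions on a glued scheme -/

section Restriction

/-- Both sides come from germs at the image of the generic point of the smaller chart, and these
germs can be compared after pulling them back to that chart. -/
lemma toRational_comp {X : Scheme.{u}} [IsIntegral X] {R S : CommRingCat.{u}} (f : Spec R ⟶ X)
    [IsOpenImmersion f] [Nonempty f.opensRange] (g : R ⟶ S) [IsOpenImmersion (Spec.map g)]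
    [IsDomain S] {f' : Spec S ⟶ X} (hf : Spec.map g ≫ f = f')
    [IsOpenImmersion f'] [Nonempty f'.opensRange] (r : R) :
    toRational f' (g r) = toRational f r := by
  subst hf
  let q : Spec S := genericPoint (Spec S)
  rw [← algebraMap_toStalk (Spec.map g ≫ f) q, ← algebraMap_toStalk f (Spec.map g q)]
  refine congrArg (algebraMap (X.presheaf.stalk (f (Spec.map g q))) X.functionField) ?_
  refine (asIso ((Spec.map g ≫ f).stalkMap q)).commRingCatIsoToRingEquiv.injective ?_
  refine (stalkMap_toStalk (Spec.map g ≫ f) q (g r)).trans ?_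
  refine Eq.trans ?_ congr($(Scheme.Hom.stalkMap_comp (Spec.map g) f q).hom
    (toStalk f (Spec.map g q) r)).symm
  refine Eq.trans ?_ (congrArg ((Spec.map g).stalkMap q)
    (stalkMap_toStalk f (Spec.map g q) r)).symm
  exact (stalkMap_toStalk_apply g q r).symm

variable {K L : Type u} [Field K] [Field L] [Algebra K L] {J : Type} [PartialOrder J]
  (R : J → Subalgebra K L) [IsGluingFamily R] [Small.{u} J] [OrderBot J]

lemma toFunctionField_eq (i : J) : toFunctionField R i = toRational (gluedι R i) := rfl

lemma toFunctionField_restrict {i j : J} (h : i ≤ j) (r : R j) :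
    toFunctionField R i (restrict R h r) = toFunctionField R j r := by
  have := isOpenImmersion_restrict R h
  exact toRational_comp (gluedι R j) (CommRingCat.ofHom (restrict R h)) (gluedι_comp R h) r

lemma toFunctionField_mul_eq {i j : J} {r : R i} {a b : R j} (h : (r : L) * b = a) :
    toFunctionField R i r * toFunctionField R j b = toFunctionField R j a := by
  rw [← toFunctionField_restrict R bot_le r, ← toFunctionField_restrict R bot_le a,
    ← toFunctionField_restrict R bot_le b, ← map_mul]
  exact congrArg _ (Subtype.ext h)

end Restriction

/-! ### Laurent monomials -/

variable (K : Type u) [Field K] (n : ℕ)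

/-- The Laurent monomial `x ^ k * y ^ m` for `p = (k, m)`. -/
def laurent (p : ℤ × ℤ) : RatFun K := x K ^ p.1 * y K ^ p.2

lemma laurent_ne_zero (p : ℤ × ℤ) : laurent K p ≠ 0 :=
  mul_ne_zero (zpow_ne_zero _ (x_ne_zero K)) (zpow_ne_zero _ (y_ne_zero K))

lemma laurent_add (p q : ℤ × ℤ) : laurent K (p + q) = laurent K p * laurent K q := by
  simp only [laurent, Prod.fst_add, Prod.snd_add, zpow_add₀ (x_ne_zero K),
    zpow_add₀ (y_ne_zero K)]
  ring

lemma laurent_zero : laurent K 0 = 1 := by simp [laurent]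

lemma laurent_nsmul (k : ℕ) (p : ℤ × ℤ) : laurent K (k • p) = laurent K p ^ k := by
  induction k with
  | zero => simp [laurent_zero]
  | succ k ih => rw [succ_nsmul, laurent_add, ih, pow_succ]

lemma algebraMap_monomial (e : Fin 2 →₀ ℕ) (c : K) :
    algebraMap (MvPolynomial (Fin 2) K) (RatFun K) (MvPolynomial.monomial e c) =
      c • laurent K (e 0, e 1) := by
  rw [MvPolynomial.monomial_eq, Finsupp.prod_fintype _ _ (by simp), ← MvPolynomial.algebraMap_eq,
    ← Algebra.smul_def]
  refine (map_smul (IsScalarTower.toAlgHom K (MvPolynomial (Fin 2) K) (RatFun K)) _ _).trans ?_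
  simp [laurent, x, y]

/-- Multiplying finitely many Laurent monomials by a high power of `x y` turns them into distinct
monomials of the polynomial ring. -/
lemma linearIndependent_laurent : LinearIndependent K (laurent K) := by
  rw [linearIndependent_iff']
  intro s g hg p hp
  obtain ⟨N, hN⟩ : ∃ N : ℕ, ∀ q ∈ s, 0 ≤ q.1 + N ∧ 0 ≤ q.2 + N := by
    refine ⟨∑ q ∈ s, (q.1.natAbs + q.2.natAbs), fun q hq => ?_⟩
    have := Finset.single_le_sum (f := fun q : ℤ × ℤ => q.1.natAbs + q.2.natAbs)
      (fun _ _ => Nat.zero_le _) hq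
    grind
  -- The truncation `toNat` is harmless for `q ∈ s`, by the choice of `N`.
  let e : ℤ × ℤ → Fin 2 →₀ ℕ := fun q =>
    Finsupp.equivFunOnFinite.symm ![(q.1 + N).toNat, (q.2 + N).toNat]
  have he : ∀ q ∈ s, laurent K q * laurent K (N, N) = laurent K (e q 0, e q 1) := by
    intro q hq
    rw [← laurent_add]
    have := hN q hq
    congr 1
    ext <;> simp [e, this]
  have hinj : ∀ q ∈ s, e q = e p → q = p := by
    intro q hq h
    have h0 := DFunLike.congr_fun h 0
    have h1 := DFunLike.congr_fun h 1
    simp only [e, Finsupp.equivFunOnFinite_symm_apply_apply, Matrix.cons_val_zero,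
      Matrix.cons_val_one] at h0 h1
    have := hN q hq
    have := hN p hp
    ext <;> omega
  have h : algebraMap (MvPolynomial (Fin 2) K) (RatFun K)
      (∑ q ∈ s, MvPolynomial.monomial (e q) (g q)) = 0 := by
    rw [map_sum, ← zero_mul (laurent K (N, N)), ← hg, Finset.sum_mul]
    refine Finset.sum_congr rfl fun q hq => ?_
    rw [algebraMap_monomial, smul_mul_assoc, he q hq]
  rw [map_eq_zero_iff _ (IsFractionRing.injective _ _)] at h
  have := congrArg (MvPolynomial.coeff (e p)) h
  rw [MvPolynomial.coeff_sum, Finset.sum_eq_single p] at this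
  · simpa using this
  · intro q hq hqp
    rw [MvPolynomial.coeff_monomial, if_neg fun h => hqp (hinj q hq h)]
  · exact fun h => absurd hp h

/-- The exponent of the base coordinate on `U_i` as a Laurent monomial. -/
def baseExp (i : Fin 2) : ℤ × ℤ := ![(1, 0), (-1, 0)] i

/-- The exponent of the fibre coordinate of the chart `(i, j)` as a Laurent monomial. -/
def fibreExp (i j : Fin 2) : ℤ × ℤ := ![![(0, -1), (0, 1)], ![((n : ℤ), -1), (-n, 1)]] i j

lemma baseCoord_eq (i : Fin 2) : baseCoord K i = laurent K (baseExp i) := by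
  fin_cases i <;> simp [baseCoord, baseExp, laurent]

lemma fibreCoord_eq (i j : Fin 2) : fibreCoord K n i j = laurent K (fibreExp n i j) := by
  fin_cases i <;> fin_cases j <;>
    simp [fibreCoord, fibreRatio, fibreExp, laurent, div_eq_mul_inv, mul_comm]

/-- The exponent of `u ^ k * v ^ l` as a Laurent monomial for `e = (k, l)`, where `u` and `v`
are the base and fibre coordinates of the chart `c`. -/
def chartExp (c : Fin 2 × Fin 2) (e : ℕ × ℕ) : ℤ × ℤ :=
  e.1 • baseExp c.1 + e.2 • fibreExp n c.1 c.2

lemma laurent_chartExp (c : Fin 2 × Fin 2) (e : ℕ × ℕ) :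
    laurent K (chartExp n c e) = baseCoord K c.1 ^ e.1 * fibreCoord K n c.1 c.2 ^ e.2 := by
  rw [chartExp, laurent_add, laurent_nsmul, laurent_nsmul, baseCoord_eq, fibreCoord_eq]

lemma chartExp_injective (c : Fin 2 × Fin 2) : Function.Injective (chartExp n c) := by
  obtain ⟨i, j⟩ := c
  rintro ⟨k, l⟩ ⟨k', l'⟩ h
  fin_cases i <;> fin_cases j <;>
    simp [chartExp, baseExp, fibreExp] at h <;> grind

/-- The exponents of the Laurent monomials that are sections of `𝒪(a E_∞ + b F_0)` over the
chart `c`. For `a = b = 0` these are the monomials in the coordinate ring of the chart. Only the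
charts over `U_1` meet `F_0`, and only those with second index `0` meet `E_∞`, so that `b` and `a`
occur in these cases only. -/
def chartCone (c : Fin 2 × Fin 2) (a b : ℤ) : Set (ℤ × ℤ) :=
  {p | (if c.1 = 0 then 0 ≤ p.1 else p.1 + n * p.2 ≤ b) ∧ if c.2 = 0 then p.2 ≤ a else 0 ≤ p.2}

lemma range_chartExp (c : Fin 2 × Fin 2) : Set.range (chartExp n c) = chartCone n c 0 0 := by
  obtain ⟨i, j⟩ := c
  ext ⟨k, m⟩
  constructor
  · rintro ⟨⟨k', l'⟩, h⟩
    rw [← h]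
    fin_cases i <;> fin_cases j <;>
      simp [chartExp, baseExp, fibreExp, chartCone] <;> grind
  · intro h
    refine ⟨(if i = 0 then k.toNat else (k + n * m).natAbs, m.natAbs), ?_⟩
    fin_cases i <;> fin_cases j <;>
      simp [chartExp, baseExp, fibreExp, chartCone] at h ⊢ <;>
      simp [h, abs_of_nonneg, abs_of_nonpos] <;> ring

/-! ### The coordinate rings of the charts -/

lemma chartsRing_single (c : Fin 2 × Fin 2) : chartsRing K n (single c) = chartRing K n c := by
  refine le_antisymm (overlapRing_le _ fun d hd => ?_) (chartRing_le_chartsRing K n c)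
  rw [Finset.mem_singleton.mp hd]
  rfl

lemma mem_chartsRing_single_iff (c : Fin 2 × Fin 2) (r : RatFun K) :
    r ∈ chartsRing K n (single c) ↔ r ∈ Submodule.span K (laurent K '' chartCone n c 0 0) := by
  rw [chartsRing_single, ← Subalgebra.mem_toSubmodule, chartRing, Algebra.adjoin_eq_span]
  congr! 2
  ext s
  rw [← range_chartExp, ← Set.range_comp]
  simp [chartCoords, Submonoid.mem_closure_pair, laurent_chartExp]

lemma algebraicIndependent_chartCoords (c : Fin 2 × Fin 2) :
    AlgebraicIndependent K ![baseCoord K c.1, fibreCoord K n c.1 c.2] := by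
  rw [algebraicIndependent_iff_injective_aeval, injective_iff_map_eq_zero]
  intro p hp
  let e : (Fin 2 →₀ ℕ) → ℤ × ℤ := fun m => chartExp n c (m 0, m 1)
  have he : Function.Injective e := by
    intro m m' h
    have := chartExp_injective n c h
    simp only [Prod.mk.injEq] at this
    ext i
    fin_cases i
    exacts [this.1, this.2]
  have := linearIndependent_iff'.mp ((linearIndependent_laurent K).comp e he) p.support
    (fun m => p.coeff m) (by
      rw [← hp, MvPolynomial.aeval_def, MvPolynomial.eval₂_eq']
      refine Finset.sum_congr rfl fun m _ => ?_
      simp [e, laurent_chartExp, Algebra.smul_def])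
  ext m
  by_contra h
  exact h (this m (MvPolynomial.mem_support_iff.mpr h))

/-- The coordinate ring of the chart `c` is the polynomial ring in its two coordinates. -/
def chartEquiv (c : Fin 2 × Fin 2) : MvPolynomial (Fin 2) K ≃ₐ[K] chartsRing K n (single c) :=
  (algebraicIndependent_chartCoords K n c).aevalEquiv.trans
    (Subalgebra.equivOfEq _ _ (by
      rw [chartsRing_single, chartRing]
      congr 1
      ext; simp [chartCoords, or_comm]))

lemma coe_chartEquiv (c : Fin 2 × Fin 2) (p : MvPolynomial (Fin 2) K) :
    (chartEquiv K n c p : RatFun K) =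
      MvPolynomial.aeval ![baseCoord K c.1, fibreCoord K n c.1 c.2] p := by
  simp [chartEquiv]

/-- The base coordinate of the chart `c` as an element of its coordinate ring. -/
def baseElt (c : Fin 2 × Fin 2) : chartsRing K n (single c) :=
  ⟨baseCoord K c.1, chartRing_le_chartsRing K n c (baseCoord_mem K n c)⟩

/-- The fibre coordinate of the chart `c` as an element of its coordinate ring. -/
def fibreElt (c : Fin 2 × Fin 2) : chartsRing K n (single c) :=
  ⟨fibreCoord K n c.1 c.2, chartRing_le_chartsRing K n c (fibreCoord_mem K n c)⟩

lemma chartEquiv_X_zero (c : Fin 2 × Fin 2) :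
    chartEquiv K n c (MvPolynomial.X 0) = baseElt K n c :=
  Subtype.ext (by simp [coe_chartEquiv, baseElt])

lemma chartEquiv_X_one (c : Fin 2 × Fin 2) :
    chartEquiv K n c (MvPolynomial.X 1) = fibreElt K n c :=
  Subtype.ext (by simp [coe_chartEquiv, fibreElt])

lemma prime_baseElt (c : Fin 2 × Fin 2) : Prime (baseElt K n c) := by
  rw [← chartEquiv_X_zero]
  exact (MulEquiv.prime_iff (chartEquiv K n c)).mpr (MvPolynomial.X_prime)

lemma prime_fibreElt (c : Fin 2 × Fin 2) : Prime (fibreElt K n c) := by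
  rw [← chartEquiv_X_one]
  exact (MulEquiv.prime_iff (chartEquiv K n c)).mpr (MvPolynomial.X_prime)

lemma not_baseElt_dvd_fibreElt (c : Fin 2 × Fin 2) : ¬ baseElt K n c ∣ fibreElt K n c := by
  rw [← chartEquiv_X_zero, ← chartEquiv_X_one, map_dvd_iff, MvPolynomial.X_dvd_X]
  simp

lemma not_fibreElt_dvd_baseElt (c : Fin 2 × Fin 2) : ¬ fibreElt K n c ∣ baseElt K n c := by
  rw [← chartEquiv_X_zero, ← chartEquiv_X_one, map_dvd_iff, MvPolynomial.X_dvd_X]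
  simp

/-- The function `transitionFun K n c d` as an element of the coordinate ring of the chart `c`. -/
def transitionElt (c d : Fin 2 × Fin 2) : chartsRing K n (single c) :=
  ⟨transitionFun K n c d, chartRing_le_chartsRing K n c (transitionFun_mem K n c d)⟩

lemma transitionElt_eq (c d : Fin 2 × Fin 2) : transitionElt K n c d =
    (if c.1 = d.1 then 1 else baseElt K n c) * (if c.2 = d.2 then 1 else fibreElt K n c) := by
  refine Subtype.ext ?_
  change transitionFun K n c d = _
  rw [transitionFun]
  split_ifs <;> rfl

variable {K} in
lemma mul_laurent_mem_span {S T : Set (ℤ × ℤ)} {t : ℤ × ℤ} (h : ∀ p ∈ S, p + t ∈ T)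
    {g : RatFun K} (hg : g ∈ Submodule.span K (laurent K '' S)) :
    g * laurent K t ∈ Submodule.span K (laurent K '' T) := by
  suffices Submodule.span K (laurent K '' S) ≤
      (Submodule.span K (laurent K '' T)).comap (LinearMap.mulRight K (laurent K t)) from this hg
  rw [Submodule.span_le]
  rintro _ ⟨p, hp, rfl⟩
  simp only [SetLike.mem_coe, Submodule.mem_comap, LinearMap.mulRight_apply, ← laurent_add]
  exact Submodule.subset_span ⟨_, h p hp, rfl⟩

variable {K} in
/-- As the Laurent monomials are linearly independent, spans of sets of them intersect in the span
of the intersection. -/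
lemma mem_span_iInter {ι : Type*} [Nonempty ι] {S : ι → Set (ℤ × ℤ)} {g : RatFun K}
    (hg : ∀ c, g ∈ Submodule.span K (laurent K '' S c)) :
    g ∈ Submodule.span K (laurent K '' ⋂ c, S c) := by
  simp only [Finsupp.mem_span_image_iff_linearCombination] at hg ⊢
  choose l hl hlg using hg
  let c₀ := Classical.arbitrary ι
  refine ⟨l c₀, ?_, hlg c₀⟩
  rw [Finsupp.mem_supported, Set.subset_iInter_iff]
  intro c
  rw [(linearIndependent_laurent K) ((hlg c₀).trans (hlg c).symm), ← Finsupp.mem_supported K]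
  exact hl c

/-- The exponent of the local equation of `a E_∞ + b F_0` in the chart `c`. -/
def localExp (c : Fin 2 × Fin 2) (a b : ℤ) : ℤ × ℤ :=
  (if c.1 = 0 then 0 else b) • baseExp c.1 + (if c.2 = 0 then a else 0) • fibreExp n c.1 c.2

lemma mem_chartCone_iff (c : Fin 2 × Fin 2) (a b : ℤ) (p : ℤ × ℤ) :
    p ∈ chartCone n c a b ↔ p + localExp n c a b ∈ chartCone n c 0 0 := by
  obtain ⟨i, j⟩ := c
  fin_cases i <;> fin_cases j <;>
    simp [chartCone, localExp, baseExp, fibreExp] <;> grind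

lemma mul_laurent_mem_chartsRing_iff (c : Fin 2 × Fin 2) (a b : ℤ) (g : RatFun K) :
    g * laurent K (localExp n c a b) ∈ chartsRing K n (single c) ↔
      g ∈ Submodule.span K (laurent K '' chartCone n c a b) := by
  rw [mem_chartsRing_single_iff]
  refine ⟨fun h => ?_, mul_laurent_mem_span fun p => (mem_chartCone_iff n c a b p).mp⟩
  have := mul_laurent_mem_span (t := -localExp n c a b) (T := chartCone n c a b) (fun p hp => by
    rwa [mem_chartCone_iff, neg_add_cancel_right]) h
  rwa [mul_assoc, ← laurent_add, add_neg_cancel, laurent_zero, mul_one] at this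

lemma iInter_chartCone (a b : ℤ) : ⋂ c, chartCone n c a b = exponents n a b := by
  ext p
  simp only [Set.mem_iInter, Prod.forall, Fin.forall_fin_two, chartCone, exponents,
    Set.mem_ofPred_eq]
  simp
  tauto

/-- The rational functions which become regular on every chart `c` after multiplication by the
local equation of `a E_∞ + b F_0` are the combinations of the monomials in `exponents n a b`. -/
lemma forall_mul_laurent_mem_iff (a b : ℤ) (g : RatFun K) :
    (∀ c, g * laurent K (localExp n c a b) ∈ chartsRing K n (single c)) ↔
      g ∈ Submodule.span K (laurent K '' exponents n a b) := by
  constructor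
  · intro h
    rw [← iInter_chartCone]
    exact mem_span_iInter fun c => (mul_laurent_mem_chartsRing_iff K n c a b g).mp (h c)
  · intro h c
    have hc : exponents n a b ⊆ chartCone n c a b := by
      rw [← iInter_chartCone]
      exact Set.iInter_subset _ c
    rw [mul_laurent_mem_chartsRing_iff]
    exact Submodule.span_mono (Set.image_mono hc) h

instance (c : Fin 2 × Fin 2) : UniqueFactorizationMonoid (chartsRing K n (single c)) :=
  (chartEquiv K n c).toMulEquiv.uniqueFactorizationMonoid inferInstance

/-! ### The function field of the surface -/

/-- The identification of `K(x, y)` with the function field of `Σ_n`, constructed on the chart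
`(0, 1)`, whose coordinate ring is `K[x, y]`. -/
def ratHom : RatFun K →+* (surface K n).functionField :=
  IsFractionRing.lift (A := MvPolynomial (Fin 2) K)
    (g := (ofChart K n).comp (chartEquiv K n (0, 1) : _ →+* chartsRing K n (single (0, 1))))
    ((toRational_injective (gluedι (chartsRing K n) (single (0, 1)))).comp
      (chartEquiv K n (0, 1)).injective)

lemma ratHom_algebraMap (p : MvPolynomial (Fin 2) K) :
    ratHom K n (algebraMap _ _ p) = ofChart K n (chartEquiv K n (0, 1) p) :=
  IsFractionRing.lift_algebraMap _ _

lemma coe_chartEquiv_zero_one (p : MvPolynomial (Fin 2) K) :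
    (chartEquiv K n (0, 1) p : RatFun K) = algebraMap _ _ p := by
  have h : MvPolynomial.aeval ![baseCoord K 0, fibreCoord K n 0 1] =
      IsScalarTower.toAlgHom K (MvPolynomial (Fin 2) K) (RatFun K) := by
    ext i
    fin_cases i <;> simp [baseCoord, fibreCoord, fibreRatio, x, y]
  rw [coe_chartEquiv, h]
  rfl

/-- On the coordinate ring of every overlap of charts, `ratHom` is the inclusion of regular
functions into rational functions. -/
lemma ratHom_coe (S : Overlap (Fin 2 × Fin 2)) (r : chartsRing K n S) :
    ratHom K n r = toFunctionField (chartsRing K n) S r := by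
  obtain ⟨a, b, hb, hr⟩ :=
    IsFractionRing.div_surjective (A := MvPolynomial (Fin 2) K) (r : RatFun K)
  have hb' := nonZeroDivisors.ne_zero hb
  have h0 : algebraMap _ (RatFun K) b ≠ 0 := by simpa using hb'
  have h0' : ratHom K n (algebraMap _ (RatFun K) b) ≠ 0 := by simpa using hb'
  rw [← hr, map_div₀, div_eq_iff h0', ratHom_algebraMap, ratHom_algebraMap]
  refine (toFunctionField_mul_eq (chartsRing K n) ?_).symm
  rw [coe_chartEquiv_zero_one, coe_chartEquiv_zero_one, ← hr, div_mul_cancel₀ _ h0]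

/-- `ratHom` as a homomorphism of `K`-algebras. -/
def ratAlgHom : RatFun K →ₐ[K] (surface K n).functionField :=
  { ratHom K n with
    commutes' := fun k => ratHom_coe K n (single (0, 1)) (algebraMap K _ k) }

lemma ratHom_laurent (p : ℤ × ℤ) : ratHom K n (laurent K p) = monomial K n p := by
  rw [laurent, map_mul, map_zpow₀, map_zpow₀, monomial]
  congr 2
  · exact ratHom_coe K n (single (0, 1)) (baseElt K n (0, 1))
  · exact ratHom_coe K n (single (0, 1)) (fibreElt K n (0, 1))

/-! ### The points of the charts -/

lemma exists_chart_eq (p : surface K n) : ∃ c q, chart K n c q = p := by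
  obtain ⟨S, q, rfl⟩ := exists_gluedι_eq (chartsRing K n) p
  obtain ⟨c, hc⟩ := (OrderDual.ofDual S).2
  have h : S ≤ single c := Finset.singleton_subset_iff.mpr hc
  refine ⟨c, Spec.map (CommRingCat.ofHom (restrict (chartsRing K n) h)) q, ?_⟩
  rw [← gluedι_comp (chartsRing K n) h]
  exact (Scheme.Hom.comp_apply _ _ _).symm

lemma chart_mem_range_of_notMem (c d : Fin 2 × Fin 2)
    (q : Spec (CommRingCat.of (chartsRing K n (single c))))
    (h : transitionElt K n c d ∉ q.asIdeal) : chart K n c q ∈ Set.range (chart K n d) := by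
  classical
  let S : Overlap (Fin 2 × Fin 2) := OrderDual.toDual ⟨{c, d}, Finset.insert_nonempty c {d}⟩
  have hSc : S ≤ single c := Finset.singleton_subset_iff.mpr (Finset.mem_insert_self c {d})
  have hSd : S ≤ single d := Finset.singleton_subset_iff.mpr
    (Finset.mem_insert_of_mem (Finset.mem_singleton_self d))
  have hc : chartRing K n c ≤ chartsRing K n S :=
    (chartRing_le_chartsRing K n c).trans (overlapRing_antitone _ hSc)
  have hd : chartRing K n d ≤ chartsRing K n S :=
    (chartRing_le_chartsRing K n d).trans (overlapRing_antitone _ hSd)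
  have hrange := range_comap_restrict (chartsRing K n) hSc (transitionElt K n c d).2
    (transitionFun_ne_zero K n c d) (sup_le hc hd (inv_transitionFun_mem K n c d))
    (overlapRing_le _ fun e he => by
      rcases Finset.mem_insert.mp he with rfl | he
      · exact (chartRing_le_chartsRing K n e).trans le_sup_left
      · rw [Finset.mem_singleton.mp he]
        exact (chartRing_le_sup_adjoin K n c d).trans
          (sup_le_sup_right (chartRing_le_chartsRing K n c) _))
  obtain ⟨q', rfl⟩ := hrange.symm.subset h
  refine ⟨Spec.map (CommRingCat.ofHom (restrict (chartsRing K n) hSd)) q', ?_⟩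
  have h1 := gluedι_comp (chartsRing K n) hSc
  have h2 := gluedι_comp (chartsRing K n) hSd
  exact (Scheme.Hom.comp_apply _ _ _).symm.trans
    ((congr($(h2.trans h1.symm) q')).trans (Scheme.Hom.comp_apply _ _ _))

/-- The elements of `K(x, y)` whose image in the function field is regular at the point `p`. -/
def regularAt (p : surface K n) : Subalgebra K (RatFun K) :=
  { (algebraMap ((surface K n).presheaf.stalk p) (surface K n).functionField).range.comap
      (ratHom K n) with
    algebraMap_mem' := fun k => by
      obtain ⟨c, q, rfl⟩ := exists_chart_eq K n p
      exact ⟨toStalk (chart K n c) q (algebraMap K _ k), (algebraMap_toStalk _ _ _).trans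
        (ratHom_coe K n (single c) (algebraMap K _ k)).symm⟩ }

lemma chartsRing_le_regularAt (c : Fin 2 × Fin 2)
    (q : Spec (CommRingCat.of (chartsRing K n (single c)))) :
    chartsRing K n (single c) ≤ regularAt K n (chart K n c q) := fun r hr =>
  ⟨toStalk (chart K n c) q ⟨r, hr⟩, (algebraMap_toStalk _ _ _).trans
    (ratHom_coe K n (single c) ⟨r, hr⟩).symm⟩

/-- If a point lies in the charts `c` and `d`, then the inverse of the transition function is
regular there, as it is a polynomial in the coordinates of both charts. -/
lemma chart_mem_range_iff (c d : Fin 2 × Fin 2)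
    (q : Spec (CommRingCat.of (chartsRing K n (single c)))) :
    chart K n c q ∈ Set.range (chart K n d) ↔ transitionElt K n c d ∉ q.asIdeal := by
  refine ⟨?_, chart_mem_range_of_notMem K n c d q⟩
  rintro ⟨q', hq'⟩
  have hc := chartsRing_le_regularAt K n c q
  have hd := chartsRing_le_regularAt K n d q'
  rw [hq'] at hd
  obtain ⟨s, hs⟩ := (sup_le ((chartRing_le_chartsRing K n c).trans hc)
    ((chartRing_le_chartsRing K n d).trans hd)) (inv_transitionFun_mem K n c d)
  rw [← isUnit_toStalk_iff (chart K n c)]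
  refine IsUnit.of_mul_eq_one s ?_
  refine IsFractionRing.injective _ (surface K n).functionField ?_
  rw [map_mul, algebraMap_toStalk, map_one]
  refine (congrArg₂ (· * ·) (ratHom_coe K n (single c) (transitionElt K n c d)).symm hs).trans ?_
  change ratHom K n (transitionFun K n c d) * ratHom K n (transitionFun K n c d)⁻¹ = 1
  rw [← map_mul, mul_inv_cancel₀ (transitionFun_ne_zero K n c d), map_one]

/-! ### The divisors `E_∞` and `F_0` -/

/-- Let `Z` be a closed subset which is cut out on each chart `c` by `e c`, which is `1` or a prime
element. If the generic points of `Z` in different charts lie in the overlaps of these charts, then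
`Z` is a prime divisor with local equations `e c`. -/
lemma primeCycle_chart (Z : Set (surface K n)) (hZ : IsClosed Z)
    (e : ∀ c : Fin 2 × Fin 2, chartsRing K n (single c)) (he : ∀ c, e c = 1 ∨ Prime (e c))
    (hmem : ∀ c q, chart K n c q ∈ Z ↔ e c ∈ q.asIdeal)
    (hirr : ∀ c d, Prime (e c) → Prime (e d) → ¬ e c ∣ transitionElt K n c d)
    (c : Fin 2 × Fin 2) (q : Spec (CommRingCat.of (chartsRing K n (single c))))
    (hq : Order.coheight (chart K n c q) = 1) :
    primeCycle Z (chart K n c q) =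
      Scheme.ord (toFunctionField (chartsRing K n) (single c) (e c)) (chart K n c q) := by
  have hprime : ∀ (d) (q' : Spec (CommRingCat.of (chartsRing K n (single d)))),
      e d ∈ q'.asIdeal → Prime (e d) := by
    intro d q' h
    refine (he d).resolve_left fun h1 => ?_
    rw [h1] at h
    exact (PrimeSpectrum.isPrime q').ne_top ((Ideal.eq_top_iff_one _).mpr h)
  have hspan : ∀ (d) (q' : Spec (CommRingCat.of (chartsRing K n (single d)))),
      e d ∈ q'.asIdeal → Order.coheight (chart K n d q') = 1 →
        q'.asIdeal = Ideal.span {e d} := by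
    intro d q' h h1
    rw [coheight_eq_height] at h1
    have := PrimeSpectrum.isPrime q'
    exact Ideal.eq_span_singleton_of_height_eq_one h1 h (hprime d q' h)
  by_cases hcq : e c ∈ q.asIdeal
  -- A point of `Z` in a chart `d` is a specialization of the generic point of `Z` in `d`, and this
  -- generic point is `chart K n c q`.
  · have hgen : IsGenericPoint (chart K n c q) Z := by
      refine Set.Subset.antisymm
        (closure_minimal (Set.singleton_subset_iff.mpr ((hmem c q).mpr hcq)) hZ) fun r hr => ?_
      obtain ⟨d, q₁, rfl⟩ := exists_chart_eq K n r
      have hd := (hmem d q₁).mp hr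
      obtain ⟨q₂, hq₂⟩ : chart K n c q ∈ Set.range (chart K n d) := by
        rw [chart_mem_range_iff, hspan c q hcq hq, Ideal.mem_span_singleton]
        exact hirr c d (hprime c q hcq) (hprime d q₁ hd)
      have hd₂ : e d ∈ q₂.asIdeal := (hmem d q₂).mp (hq₂ ▸ (hmem c q).mpr hcq)
      have hle : q₂.asIdeal ≤ q₁.asIdeal := by
        rw [hspan d q₂ hd₂ (hq₂ ▸ hq), Ideal.span_singleton_le_iff_mem]
        exact hd
      rw [← hq₂, ← specializes_iff_mem_closure]
      exact ((PrimeSpectrum.le_iff_specializes q₂ q₁).mp hle).map (chart K n d).continuous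
    rw [toFunctionField_eq]
    refine Eq.trans ?_ (ord_toRational_eq_one (chart K n c) hq (hprime c q hcq).ne_zero
      (hspan c q hcq hq)).symm
    exact Set.indicator_of_mem (s := {p | IsGenericPoint p Z}) hgen 1
  · rw [toFunctionField_eq]
    refine Eq.trans ?_ (ord_toRational_eq_zero (chart K n c) hcq).symm
    exact Set.indicator_of_notMem (s := {p | IsGenericPoint p Z})
      (fun h => hcq ((hmem c q).mp (IsGenericPoint.mem h))) 1

/-- The local equation of `F_0` in the chart `c`. -/
def fZeroEq (c : Fin 2 × Fin 2) : chartsRing K n (single c) :=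
  if c.1 = 0 then 1 else baseElt K n c

/-- The local equation of `E_∞` in the chart `c`. -/
def eInftyEq (c : Fin 2 × Fin 2) : chartsRing K n (single c) :=
  if c.2 = 0 then fibreElt K n c else 1

lemma isClosed_FZero : IsClosed (FZero K n) := by
  simp only [FZero, Set.ofPred_forall]
  exact isClosed_iInter fun j => (chart K n (0, j)).isOpenEmbedding.isOpen_range.isClosed_compl

lemma isClosed_EInfty : IsClosed (EInfty K n) := by
  simp only [EInfty, Set.ofPred_forall]
  exact isClosed_iInter fun j => (chart K n (j, 1)).isOpenEmbedding.isOpen_range.isClosed_compl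

lemma chart_mem_FZero_iff (c : Fin 2 × Fin 2)
    (q : Spec (CommRingCat.of (chartsRing K n (single c)))) :
    chart K n c q ∈ FZero K n ↔ fZeroEq K n c ∈ q.asIdeal := by
  have h : chart K n c q ∈ FZero K n ↔ ∀ j, transitionElt K n c (0, j) ∈ q.asIdeal := by
    simp only [FZero, Set.mem_ofPred_eq, chart_mem_range_iff, not_not]
  rw [h]
  simp only [transitionElt_eq, fZeroEq]
  refine ⟨fun h => by simpa using h c.2, fun h j => Ideal.mul_mem_right _ _ h⟩

lemma chart_mem_EInfty_iff (c : Fin 2 × Fin 2)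
    (q : Spec (CommRingCat.of (chartsRing K n (single c)))) :
    chart K n c q ∈ EInfty K n ↔ eInftyEq K n c ∈ q.asIdeal := by
  have h : chart K n c q ∈ EInfty K n ↔ ∀ i, transitionElt K n c (i, 1) ∈ q.asIdeal := by
    simp only [EInfty, Set.mem_ofPred_eq, chart_mem_range_iff, not_not]
  rw [h]
  have h2 : (if c.2 = 1 then 1 else fibreElt K n c) = eInftyEq K n c := by
    rw [eInftyEq]; grind
  simp only [transitionElt_eq, h2]
  refine ⟨fun h => by simpa using h c.1, fun h j => Ideal.mul_mem_left _ _ h⟩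

lemma primeCycle_FZero (c : Fin 2 × Fin 2)
    (q : Spec (CommRingCat.of (chartsRing K n (single c))))
    (hq : Order.coheight (chart K n c q) = 1) :
    primeCycle (FZero K n) (chart K n c q) =
      Scheme.ord (toFunctionField (chartsRing K n) (single c) (fZeroEq K n c))
        (chart K n c q) := by
  refine primeCycle_chart K n _ (isClosed_FZero K n) (fZeroEq K n) (fun c => ?_)
    (chart_mem_FZero_iff K n) (fun c d hc hd h => ?_) c q hq
  · by_cases h : c.1 = 0
    · simp [fZeroEq, h]
    · simp [fZeroEq, h, prime_baseElt]
  · have hc' : c.1 ≠ 0 := fun h => by simp [fZeroEq, h] at hc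
    have hd' : d.1 ≠ 0 := fun h => by simp [fZeroEq, h] at hd
    have hcd : c.1 = d.1 := by omega
    rw [transitionElt_eq, if_pos hcd, one_mul, fZeroEq, if_neg hc'] at h
    split_ifs at h
    · exact (prime_baseElt K n c).not_isUnit (isUnit_of_dvd_one h)
    · exact not_baseElt_dvd_fibreElt K n c h

lemma primeCycle_EInfty (c : Fin 2 × Fin 2)
    (q : Spec (CommRingCat.of (chartsRing K n (single c))))
    (hq : Order.coheight (chart K n c q) = 1) :
    primeCycle (EInfty K n) (chart K n c q) =
      Scheme.ord (toFunctionField (chartsRing K n) (single c) (eInftyEq K n c))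
        (chart K n c q) := by
  refine primeCycle_chart K n _ (isClosed_EInfty K n) (eInftyEq K n) (fun c => ?_)
    (chart_mem_EInfty_iff K n) (fun c d hc hd h => ?_) c q hq
  · by_cases h : c.2 = 0
    · simp [eInftyEq, h, prime_fibreElt]
    · simp [eInftyEq, h]
  · have hc' : c.2 = 0 := by
      by_contra h
      simp [eInftyEq, h] at hc
    have hd' : d.2 = 0 := by
      by_contra h
      simp [eInftyEq, h] at hd
    rw [transitionElt_eq, if_pos (hc'.trans hd'.symm), mul_one, eInftyEq, if_pos hc'] at h
    split_ifs at h
    · exact (prime_fibreElt K n c).not_isUnit (isUnit_of_dvd_one h)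
    · exact not_fibreElt_dvd_baseElt K n c h

/-! ### Global sections -/

lemma laurent_zsmul (k : ℤ) (p : ℤ × ℤ) : laurent K (k • p) = laurent K p ^ k := by
  simp only [laurent, Prod.smul_fst, Prod.smul_snd, smul_eq_mul, mul_zpow, ← zpow_mul, mul_comm k]

lemma laurent_localExp (c : Fin 2 × Fin 2) (a b : ℤ) :
    laurent K (localExp n c a b) =
      (eInftyEq K n c : RatFun K) ^ a * (fZeroEq K n c : RatFun K) ^ b := by
  rw [localExp, laurent_add, laurent_zsmul, laurent_zsmul, ← baseCoord_eq, ← fibreCoord_eq,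
    eInftyEq, fZeroEq, mul_comm]
  split_ifs <;> simp [baseElt, fibreElt]

/-- Multiplication by the local equation of a divisor adds its coefficients to the orders. -/
lemma ord_mul_local (a b : ℤ) (c : Fin 2 × Fin 2)
    (q : Spec (CommRingCat.of (chartsRing K n (single c))))
    (hq : Order.coheight (chart K n c q) = 1) {f : (surface K n).functionField} (hf : f ≠ 0) :
    Scheme.ord (f * ratHom K n (laurent K (localExp n c a b))) (chart K n c q) =
      Scheme.ord f (chart K n c q) + divisor K n a b (chart K n c q) := by
  have hD : divisor K n a b (chart K n c q) = a * primeCycle (EInfty K n) (chart K n c q) +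
      b * primeCycle (FZero K n) (chart K n c q) := rfl
  have h1 : ratHom K n (eInftyEq K n c) ≠ 0 := by
    rw [map_ne_zero, eInftyEq]
    split_ifs
    exacts [Subtype.coe_ne_coe.mpr (prime_fibreElt K n c).ne_zero, one_ne_zero]
  have h2 : ratHom K n (fZeroEq K n c) ≠ 0 := by
    rw [map_ne_zero, fZeroEq]
    split_ifs
    exacts [one_ne_zero, Subtype.coe_ne_coe.mpr (prime_baseElt K n c).ne_zero]
  rw [hD, primeCycle_EInfty K n c q hq, primeCycle_FZero K n c q hq, laurent_localExp, map_mul,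
    map_zpow₀, map_zpow₀, Scheme.ord_mul hf (mul_ne_zero (zpow_ne_zero _ h1) (zpow_ne_zero _ h2)),
    Scheme.ord_mul (zpow_ne_zero _ h1) (zpow_ne_zero _ h2), ord_zpow _ h1, ord_zpow _ h2,
    ratHom_coe, ratHom_coe]

/-- The sections of `𝒪(D)` are the rational functions whose product with the local equation of `D`
is regular on every chart. -/
lemma mem_globalSections_iff (a b : ℤ) (f : (surface K n).functionField) :
    f ∈ globalSections (divisor K n a b) ↔
      ∀ c, ∃ r : chartsRing K n (single c),
        ratHom K n r = f * ratHom K n (laurent K (localExp n c a b)) := by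
  have h0 : ∀ c, ratHom K n (laurent K (localExp n c a b)) ≠ 0 := fun c => by
    simpa using laurent_ne_zero K _
  by_cases hf : f = 0
  · subst hf
    exact ⟨fun _ c => ⟨0, by simp⟩, fun _ => Or.inl rfl⟩
  constructor
  · rintro (h | h) c
    · exact absurd h hf
    · obtain ⟨r, hr⟩ := mem_range_toRational (chart K n c) (mul_ne_zero hf (h0 c)) fun q hq => by
        rw [ord_mul_local K n a b c q hq hf]
        exact h _ hq
      exact ⟨r, (ratHom_coe K n (single c) r).trans hr⟩
  · refine fun h => Or.inr fun p hp => ?_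
    obtain ⟨c, q, rfl⟩ := exists_chart_eq K n p
    obtain ⟨r, hr⟩ := h c
    have hr0 : r ≠ 0 := by
      rintro rfl
      exact mul_ne_zero hf (h0 c) (by rw [← hr]; simp)
    rw [← ord_mul_local K n a b c q hp hf, ← hr, ratHom_coe]
    exact ord_toRational_nonneg (chart K n c) q hr0

lemma mem_globalSections_iff_exists (a b : ℤ) (f : (surface K n).functionField) :
    f ∈ globalSections (divisor K n a b) ↔
      ∃ g ∈ Submodule.span K (laurent K '' exponents n a b), ratHom K n g = f := by
  simp only [mem_globalSections_iff, ← forall_mul_laurent_mem_iff]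
  constructor
  · intro h
    obtain ⟨r, hr⟩ := h (0, 1)
    have h1 : localExp n (0, 1) a b = 0 := by simp [localExp]
    rw [h1, laurent_zero, map_one, mul_one] at hr
    refine ⟨r, fun c => ?_, hr⟩
    obtain ⟨s, hs⟩ := h c
    rw [← hr, ← map_mul] at hs
    rw [← (ratHom K n).injective hs]
    exact s.2
  · rintro ⟨g, hg, rfl⟩ c
    exact ⟨⟨_, hg c⟩, map_mul _ _ _⟩

end Hirzebruch

end

theorem proposition4p4 (K : Type u) [Field K] (n : ℕ) (a b : ℤ) :
    LinearIndependent K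
      (fun p : Hirzebruch.exponents n a b => Hirzebruch.monomial K n (p : ℤ × ℤ)) ∧
    Hirzebruch.globalSections (Hirzebruch.divisor K n a b) =
      (Submodule.span K (Hirzebruch.monomial K n '' Hirzebruch.exponents n a b) :
        Set (Hirzebruch.surface K n).functionField) := by
  have h : Hirzebruch.monomial K n = Hirzebruch.ratAlgHom K n ∘ Hirzebruch.laurent K :=
    funext fun p => (Hirzebruch.ratHom_laurent K n p).symm
  constructor
  · have := (Hirzebruch.linearIndependent_laurent K).map' (Hirzebruch.ratAlgHom K n).toLinearMap
      (LinearMap.ker_eq_bot.mpr (Hirzebruch.ratHom K n).injective)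
    rw [h]
    exact this.comp _ Subtype.val_injective
  · ext f
    rw [Hirzebruch.mem_globalSections_iff_exists, h, Set.image_comp, SetLike.mem_coe]
    exact congr(f ∈ $(Submodule.map_span (Hirzebruch.ratAlgHom K n).toLinearMap
      (Hirzebruch.laurent K '' Hirzebruch.exponents n a b))).to_iff
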